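/- Let $\mathcal H$ be a separable complex Hilbert space and let $\|K\|_1=\sum_k s_k(K)$ be the trace norm of a compact operator $K$, where the $s_k(K)$ are the singular values of $K$ (the square roots of the non-zero eigenvalues of $K^*K$, counted with multiplicity); $\mathcal L^1$ is the set of compact operators with $\|K\|_1<\infty$. For $0<\theta<\pi/2$ let $S_\theta=\{z\in\mathbb C: \operatorname{Re} z>0,\ |\arg z|<\theta\}$, with closure $\overline S_\theta$. Let $\{U(z)\}_{z\in S_\theta\cup\{0\}}$ be a quasi-bounded holomorphic Gibbs semigroup in $S_\theta$, $0<\theta<\pi/2$. This means: $U(0)=1$; $z\mapsto U(z)\in\mathcal L(\mathcal H)$ is holomorphic on $S_\theta$ and $U(z+z')=U(z)U(z')$ for $z,z'\in S_\theta$; for every $0<\theta'<\theta$, $U(z)\to 1$ strongly as $z\to0$ in $\overline S_{\theta'}$, and there are $M_{\theta'}\ge1$, $\omega_{\theta'}\in\mathbb R$ with $\|U(z)\|\le M_{\theta'}e^{\omega_{\theta'}|z|}$ for $z\in\overline S_{\theta'}$; and $U(z)\in\mathcal L^1$ for every $z\in S_\theta$. Let $A$ be its generator, $Ax=\lim_{t\downarrow0}(x-U(t)x)/t$,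 whose domain is the set of all $x\in\mathcal H$ for which this limit exists, and write $e^{-zA}=U(z)$. Let $f$ be smoothly varying at infinity with index $p$ for some $p>0$: $f$ is a positive smooth function on $[a,\infty)$ for some $a>0$, and $h(x)=\ln f(e^x)$ satisfies $h'(x)\to p$ and $h^{(n)}(x)\to0$ for every $n\ge2$ as $x\to\infty$. Put $g(t)=f(t^{-1})$ for small $t>0$. For real functions $u,v$ defined for small $t>0$, $u(t)=O_0(v(t))$ means that $v$ has no zeros near $0$ and $\limsup_{t\downarrow0}|u(t)/v(t)|<\infty$. If $\|e^{-tA}\|_1=O_0(g(t))$, then for every integer $n\ge0$ the operator $A^ne^{-tA}$ is everywhere defined and belongs to $\mathcal L^1$ for all $t>0$, and $$\|A^n e^{-tA}\|_1=O_0\big(g^{(n)}(t)\big).$$ -/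

import Mathlib

open Filter Topology Asymptotics
open scoped NNReal ENNReal ContDiff

noncomputable section

namespace GibbsSemigroup

/-! ### Trace class operators -/

section TraceClass

variable {H : Type*} [NormedAddCommGroup H] [InnerProductSpace ℂ H] [CompleteSpace H]

/-- The trace norm `‖K‖₁ = ∑ₖ sₖ(K)` of a compact operator `K`. The singular values are the
`s ≥ 0` such that `s ^ 2` is an eigenvalue of `K* K`, each one counted with the dimension of the
eigenspace of `K* K` for `s ^ 2` (finite for `s ≠ 0`, as `K` is compact). -/
def traceNorm (K : H →L[ℂ] H) : ℝ≥0∞ :=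
  ∑' s : ℝ≥0, (Module.finrank ℂ
    (Module.End.eigenspace ((K.adjoint ∘L K : H →L[ℂ] H) : Module.End ℂ H)
      (((s ^ 2 : ℝ≥0) : ℝ) : ℂ)) : ℝ≥0∞) * (s : ℝ≥0∞)

/-- The trace class: compact operators whose singular values are summable. -/
def IsTraceClass (K : H →L[ℂ] H) : Prop :=
  IsCompactOperator K ∧ traceNorm K ≠ ⊤

end TraceClass

/-! ### Unbounded operators -/

section Unbounded

variable {H : Type*} [AddCommGroup H] [Module ℂ H]

/-- The composition `B A` of unbounded operators on its natural domain
`{x ∈ Dom A | A x ∈ Dom B}`. -/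
def comp (B A : H →ₗ.[ℂ] H) : H →ₗ.[ℂ] H :=
  B.comp (A.domRestrict ((B.domain.comap A.toFun).map A.domain.subtype)) fun x => by
    obtain ⟨x, ⟨y, hy, rfl⟩, _⟩ := x
    exact hy

/-- The powers of an unbounded operator on their natural domains: `A ^ 0` is the identity of the
whole space, and `A ^ (n + 1) = A A ^ n`. -/
def pow (A : H →ₗ.[ℂ] H) : ℕ → (H →ₗ.[ℂ] H)
  | 0 => LinearMap.id.toPMap ⊤
  | n + 1 => comp A (pow A n)

end Unbounded

/-! ### Holomorphic semigroups -/

/-- The open sector with vertex `0` and semi-angle `θ`. -/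
def sector (θ : ℝ) : Set ℂ := {z | 0 < z.re ∧ |z.arg| < θ}

section Semigroup

variable {H : Type*} [NormedAddCommGroup H] [InnerProductSpace ℂ H] [CompleteSpace H]

/-- `{U z}`, for `z` in the open sector of semi-angle `θ` or `z = 0`, is a quasi-bounded
holomorphic semigroup. The values of `U` elsewhere play no role. -/
structure IsQuasiBoundedHolomorphic (θ : ℝ) (U : ℂ → H →L[ℂ] H) : Prop where
  map_zero : U 0 = ContinuousLinearMap.id ℂ H
  map_add : ∀ z ∈ sector θ, ∀ w ∈ sector θ, U (z + w) = U z ∘L U w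
  holomorphic : DifferentiableOn ℂ U (sector θ)
  strongly_continuous : ∀ θ', 0 < θ' → θ' < θ → ∀ x : H,
    Tendsto (fun z => U z x) (𝓝[closure (sector θ')] 0) (𝓝 x)
  quasi_bounded : ∀ θ', 0 < θ' → θ' < θ → ∃ M c : ℝ, 1 ≤ M ∧
    ∀ z ∈ closure (sector θ'), ‖U z‖ ≤ M * Real.exp (c * ‖z‖)

/-- A quasi-bounded holomorphic Gibbs semigroup: the operators `U z` of the open sector are of
trace class. -/
structure IsHolomorphicGibbs (θ : ℝ) (U : ℂ → H →L[ℂ] H) : Prop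
    extends IsQuasiBoundedHolomorphic θ U where
  traceClass : ∀ z ∈ sector θ, IsTraceClass (U z)

/-- `A` is the generator of `{U t}`, `t ≥ 0`, in the sign convention `U t = exp (-t A)`: the domain
of `A` consists of the `x` for which `(x - U t x) / t` converges as `t` decreases to `0`, and `A x`
is the limit. -/
def IsGenerator (A : H →ₗ.[ℂ] H) (U : ℂ → H →L[ℂ] H) : Prop :=
  ∀ x y : H, (x, y) ∈ A.graph ↔
    Tendsto (fun t : ℝ => (t : ℂ)⁻¹ • (x - U (t : ℂ) x)) (𝓝[>] 0) (𝓝 y)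

end Semigroup

/-! ### Asymptotics -/

/-- `f` varies smoothly at infinity with index `p`. Only the restriction of `f` to a half-line
`[a, ∞)` matters. -/
def SmoothlyVaryingWith (p : ℝ) (f : ℝ → ℝ) : Prop :=
  (∃ a : ℝ, 0 < a ∧ (∀ x ∈ Set.Ici a, 0 < f x) ∧ ContDiffOn ℝ ∞ f (Set.Ici a)) ∧
  Tendsto (deriv fun x => Real.log (f (Real.exp x))) atTop (𝓝 p) ∧
  ∀ n : ℕ, 2 ≤ n →
    Tendsto (iteratedDeriv n fun x => Real.log (f (Real.exp x))) atTop (𝓝 0)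

/-- `f` varies smoothly at infinity with some positive index. -/
def SmoothlyVarying (f : ℝ → ℝ) : Prop := ∃ p : ℝ, 0 < p ∧ SmoothlyVaryingWith p f

/-- `u t = O (v t)` as `t` decreases to `0`, where `v` has no zero near `0`: the quotient
`|u t / v t|` is defined and bounded for all small `t > 0`. -/
def IsBigOAtZero (u v : ℝ → ℝ) : Prop :=
  (∀ᶠ t in 𝓝[>] (0 : ℝ), v t ≠ 0) ∧ u =O[𝓝[>] 0] v

end GibbsSemigroup

end

/-!
Trace norm estimates for `A ^ n exp (-t A)`, where `-A` generates a holomorphic Gibbs semigroup.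

The operator `A ^ n exp (-t A)` is `(-1) ^ n` times the `n`-th derivative of `U` at `t`
(`IsGenerator.pow_comp_eq`). By the semigroup law it factors as `U⁽ⁿ⁾ (t / 2) ∘ U (t / 2)`. The
first factor is bounded by a multiple of `t ^ (-n)`, by Cauchy's estimate on discs inside a smaller
sector (`IsQuasiBoundedHolomorphic.exists_norm_iteratedDeriv_le`). The second is of trace class, and
its trace norm is `O (g (t / 2)) = O (g t)`, where `g t = f t⁻¹` (`isBigO_comp_half_inv`). The trace
norm is an ideal norm, so the trace norm of the product is `O (t ^ (-n) * g t)`.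

It remains to compare `t ^ (-n) * g t` with the `n`-th derivative of `g`. In the variable
`x = -log t`, the function `g` is the exponential of `h x = log (f (exp x))`, and so
`t ^ n * g⁽ⁿ⁾ t / g t` is a polynomial in `h'` and its derivatives, which converges to
`(-1) ^ n * p * (p + 1) * ⋯ * (p + n - 1)` (`exists_iteratedDeriv_eq`). As `p > 0`, this limit is
not zero.

The ideal property `‖B K‖₁ ≤ ‖B‖ ‖K‖₁` is proved without the minimax principle: for every Hilbert
basis `e` one has `‖L‖₁ ≤ ∑ₖ ‖L eₖ‖` (`traceNorm_le_tsum_enorm`), and for compact `L` there is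
equality if `e` consists of eigenvectors of `L* L` (`exists_hilbertBasis_tsum_enorm_eq`). Apply the
inequality to `L = B K` and a basis for which equality holds for `K`.
-/

namespace GibbsSemigroup

/-! ### Trace norms and Hilbert bases -/

section TraceNorm

open Module

variable {H : Type*} [NormedAddCommGroup H] [InnerProductSpace ℂ H] [CompleteSpace H]

/-- The eigenspace of `K* K` for the eigenvalue `s ^ 2`; its dimension is the multiplicity of the
singular value `s` of `K`. -/
noncomputable def singularSpace (K : H →L[ℂ] H) (s : ℝ≥0) : Submodule ℂ H :=
  End.eigenspace ((K.adjoint ∘L K : H →L[ℂ] H) : End ℂ H) (((s ^ 2 : ℝ≥0) : ℝ) : ℂ)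

theorem inner_map_map_of_mem_singularSpace {K : H →L[ℂ] H} {s : ℝ≥0} {x : H}
    (hx : x ∈ singularSpace K s) (y : H) :
    inner ℂ (K y) (K x) = ((s : ℝ) ^ 2 : ℂ) * inner ℂ y x := by
  have h : K.adjoint (K x) = ((s : ℝ) ^ 2 : ℂ) • x := by
    have := End.mem_eigenspace_iff.mp hx
    simpa using this
  rw [← ContinuousLinearMap.adjoint_inner_right, h, inner_smul_right]

theorem norm_map_of_mem_singularSpace {K : H →L[ℂ] H} {s : ℝ≥0} {x : H}
    (hx : x ∈ singularSpace K s) : ‖K x‖ = s * ‖x‖ := by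
  have h := inner_map_map_of_mem_singularSpace hx x
  rw [inner_self_eq_norm_sq_to_K, inner_self_eq_norm_sq_to_K] at h
  have h' : ‖K x‖ ^ 2 = (s * ‖x‖) ^ 2 := by
    have h1 : (‖K x‖ : ℂ) ^ 2 = ((s : ℝ) : ℂ) ^ 2 * (‖x‖ : ℂ) ^ 2 := h
    rw [mul_pow]
    exact_mod_cast h1
  exact (sq_eq_sq₀ (norm_nonneg _) (by positivity)).mp h'

theorem isSymmetric_adjoint_comp_self (K : H →L[ℂ] H) :
    ((K.adjoint ∘L K : H →L[ℂ] H) : H →ₗ[ℂ] H).IsSymmetric := by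
  intro x y
  simp [ContinuousLinearMap.adjoint_inner_left, ContinuousLinearMap.adjoint_inner_right]

/-- Every eigenvector of `K* K` lies in one of the spaces `singularSpace K s`. -/
theorem exists_mem_singularSpace {K : H →L[ℂ] H} {μ : ℂ} {x : H}
    (hx : x ∈ End.eigenspace ((K.adjoint ∘L K : H →L[ℂ] H) : End ℂ H) μ) :
    ∃ s : ℝ≥0, x ∈ singularSpace K s := by
  rcases eq_or_ne x 0 with rfl | hx0
  · exact ⟨0, Submodule.zero_mem _⟩
  have h : K.adjoint (K x) = μ • x := by simpa using End.mem_eigenspace_iff.mp hx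
  have h2 : ((‖K x‖ : ℂ)) ^ 2 = μ * (‖x‖ : ℂ) ^ 2 := by
    have := ContinuousLinearMap.adjoint_inner_right K x (K x)
    rw [h, inner_smul_right, inner_self_eq_norm_sq_to_K, inner_self_eq_norm_sq_to_K] at this
    exact this.symm
  have hn : (‖x‖ : ℂ) ≠ 0 := by simpa using hx0
  refine ⟨‖K x‖₊ / ‖x‖₊, ?_⟩
  have : μ = ((((‖K x‖₊ / ‖x‖₊) ^ 2 : ℝ≥0) : ℝ) : ℂ) := by
    push_cast
    rw [div_pow, h2, mul_div_cancel_right₀]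
    exact pow_ne_zero 2 hn
  rw [singularSpace, ← this]
  exact hx

/-- An orthonormal family that runs through a basis of each of the spaces `singularSpace K s` with
`s ≠ 0`, as far as they are of finite dimension. -/
theorem exists_orthonormal_singularSpace (K : H →L[ℂ] H) :
    ∃ v : (Σ s : {s : ℝ≥0 // s ≠ 0}, Fin (finrank ℂ (singularSpace K s))) → H,
      Orthonormal ℂ v ∧ (∀ i, v i ∈ singularSpace K i.1) ∧
      ∀ s : {s : ℝ≥0 // s ≠ 0}, FiniteDimensional ℂ (singularSpace K s) →
        singularSpace K s ≤ Submodule.span ℂ (Set.range fun j => v ⟨s, j⟩) := by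
  have key : ∀ E : Submodule ℂ H, ∃ b : Fin (finrank ℂ E) → E, Orthonormal ℂ b ∧
      (FiniteDimensional ℂ E → Submodule.span ℂ (Set.range b) = ⊤) := by
    intro E
    by_cases hE : FiniteDimensional ℂ E
    · exact ⟨stdOrthonormalBasis ℂ E, (stdOrthonormalBasis ℂ E).orthonormal, fun _ => by
        simpa using (stdOrthonormalBasis ℂ E).toBasis.span_eq⟩
    · have h0 : finrank ℂ E = 0 := finrank_of_not_finite hE
      have : IsEmpty (Fin (finrank ℂ E)) := by rw [h0]; infer_instance
      exact ⟨isEmptyElim, ⟨isEmptyElim, fun i => isEmptyElim i⟩, fun h => absurd h hE⟩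
  choose b hb hspan using fun s : {s : ℝ≥0 // s ≠ 0} => key (singularSpace K s)
  have hinj : Function.Injective
      fun s : {s : ℝ≥0 // s ≠ 0} => ((((s : ℝ≥0) ^ 2 : ℝ≥0) : ℝ) : ℂ) := by
    intro s t h
    have h' : (s : ℝ≥0) ^ 2 = (t : ℝ≥0) ^ 2 := NNReal.coe_injective (Complex.ofReal_injective h)
    exact Subtype.ext ((sq_eq_sq₀ zero_le zero_le).mp h')
  have horth := ((isSymmetric_adjoint_comp_self K).orthogonalFamily_eigenspaces).comp hinj
  refine ⟨fun i => (b i.1 i.2 : H), horth.orthonormal_sigma_orthonormal hb,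
    fun i => (b i.1 i.2).2, fun s hs x hx => ?_⟩
  have hx' : (⟨x, hx⟩ : singularSpace K s) ∈ Submodule.span ℂ (Set.range (b s)) := by
    rw [hspan s hs]; trivial
  have := Submodule.mem_map_of_mem (f := (singularSpace K s).subtype) hx'
  rw [Submodule.map_span, ← Set.range_comp] at this
  exact this

/-- The trace norm as a sum of singular values, repeated according to multiplicity. -/
theorem traceNorm_eq_tsum (K : H →L[ℂ] H) :
    traceNorm K = ∑' i : (Σ s : {s : ℝ≥0 // s ≠ 0}, Fin (finrank ℂ (singularSpace K s))),
      ((i.1 : ℝ≥0) : ℝ≥0∞) := by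
  rw [ENNReal.tsum_sigma']
  simp only [tsum_fintype, Finset.sum_const, Finset.card_univ, Fintype.card_fin, nsmul_eq_mul]
  symm
  refine tsum_subtype_eq_of_support_subset (s := {s : ℝ≥0 | s ≠ 0})
    (f := fun s : ℝ≥0 => (finrank ℂ (singularSpace K s) : ℝ≥0∞) * (s : ℝ≥0∞)) ?_
  intro s hs h0
  simp [h0] at hs

omit [CompleteSpace H] in
/-- Cauchy–Schwarz together with Bessel's inequality. -/
theorem sum_norm_inner_mul_norm_inner_le {ι : Type*} {u v : ι → H} (hu : Orthonormal ℂ u)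
    (hv : Orthonormal ℂ v) (I : Finset ι) (x y : H) :
    ∑ i ∈ I, ‖inner ℂ (u i) y‖ * ‖inner ℂ x (v i)‖ ≤ ‖y‖ * ‖x‖ := by
  have h1 := hu.sum_inner_products_le y (s := I)
  have h2 := hv.sum_inner_products_le x (s := I)
  have h3 := Finset.sum_mul_sq_le_sq_mul_sq I (fun i => ‖inner ℂ (u i) y‖)
    (fun i => ‖inner ℂ x (v i)‖)
  refine le_of_sq_le_sq ?_ (by positivity)
  rw [mul_pow]
  refine h3.trans (mul_le_mul h1 ?_ (by positivity) (by positivity))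
  simpa only [norm_inner_symm] using h2

/-- The trace norm is at most the sum of the norms of the images of a Hilbert basis. -/
theorem traceNorm_le_tsum_enorm (L : H →L[ℂ] H) {κ : Type*} (e : HilbertBasis κ ℂ H) :
    traceNorm L ≤ ∑' k, ‖L (e k)‖ₑ := by
  obtain ⟨v, hv, hmem, -⟩ := exists_orthonormal_singularSpace L
  rw [traceNorm_eq_tsum, ENNReal.tsum_eq_iSup_sum]
  refine iSup_le fun I => ?_
  -- the left singular vectors
  set u := fun i => (((i.1 : ℝ≥0) : ℝ) : ℂ)⁻¹ • L (v i) with hu_def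
  have hne : ∀ i : (Σ s : {s : ℝ≥0 // s ≠ 0}, Fin (finrank ℂ (singularSpace L s))),
      (((i.1 : ℝ≥0) : ℝ) : ℂ) ≠ 0 := fun i => by exact_mod_cast i.1.2
  have hu : Orthonormal ℂ u := by
    classical
    rw [orthonormal_iff_ite] at hv ⊢
    intro i j
    rw [hu_def, inner_smul_left, inner_smul_right,
      inner_map_map_of_mem_singularSpace (hmem j), hv i j]
    split_ifs with hij
    · subst hij
      have := hne i
      simp only [map_inv₀, Complex.conj_ofReal]
      field_simp
    · simp
  have hs : ∀ i, ((i.1 : ℝ≥0) : ℝ≥0∞) ≤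
      ∑' k, ENNReal.ofReal (‖inner ℂ (u i) (L (e k))‖ * ‖inner ℂ (e k) (v i)‖) := by
    intro i
    have h1 : inner ℂ (u i) (L (v i)) = (((i.1 : ℝ≥0) : ℝ) : ℂ) := by
      have := hne i
      rw [hu_def, inner_smul_left, inner_map_map_of_mem_singularSpace (hmem i),
        inner_self_eq_norm_sq_to_K, hv.1 i]
      simp only [map_inv₀, Complex.conj_ofReal]
      field_simp
      simp
    have h2 := e.hasSum_inner_mul_inner (L.adjoint (u i)) (v i)
    simp only [ContinuousLinearMap.adjoint_inner_left, h1] at h2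
    have h3 := enorm_tsum_le_tsum_enorm (f := fun k => inner ℂ (u i) (L (e k)) * inner ℂ (e k) (v i))
    rw [h2.tsum_eq] at h3
    have h4 : ‖(((i.1 : ℝ≥0) : ℝ) : ℂ)‖ₑ = ((i.1 : ℝ≥0) : ℝ≥0∞) := by
      simp [enorm_eq_nnnorm]
    rw [h4] at h3
    refine h3.trans_eq (tsum_congr fun k => ?_)
    rw [← ofReal_norm, norm_mul]
  calc ∑ i ∈ I, ((i.1 : ℝ≥0) : ℝ≥0∞)
      ≤ ∑ i ∈ I, ∑' k, ENNReal.ofReal (‖inner ℂ (u i) (L (e k))‖ * ‖inner ℂ (e k) (v i)‖) :=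
        Finset.sum_le_sum fun i _ => hs i
    _ = ∑' k, ∑ i ∈ I, ENNReal.ofReal (‖inner ℂ (u i) (L (e k))‖ * ‖inner ℂ (e k) (v i)‖) :=
        (Summable.tsum_finsetSum fun _ _ => ENNReal.summable).symm
    _ ≤ ∑' k, ‖L (e k)‖ₑ := by
        refine ENNReal.tsum_le_tsum fun k => ?_
        rw [← ENNReal.ofReal_sum_of_nonneg fun _ _ => by positivity, ← ofReal_norm]
        refine ENNReal.ofReal_le_ofReal ?_
        simpa [e.orthonormal.1 k] using sum_norm_inner_mul_norm_inner_le hu hv I (e k) (L (e k))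

/-- For a compact operator `K`, the sum in `traceNorm_le_tsum_enorm` is minimal for a Hilbert basis
of eigenvectors of `K* K`. -/
theorem exists_hilbertBasis_tsum_enorm_eq (K : H →L[ℂ] H) (hK : IsCompactOperator K) :
    ∃ (w : Set H) (e : HilbertBasis w ℂ H), ∑' k, ‖K (e k)‖ₑ = traceNorm K := by
  obtain ⟨v, hv, hmem, hspan⟩ := exists_orthonormal_singularSpace K
  have hT : IsCompactOperator (K.adjoint ∘L K) := hK.clm_comp K.adjoint
  have hsym := isSymmetric_adjoint_comp_self K
  -- a vector orthogonal to all right singular vectors lies in the kernel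
  have hker : ∀ x : H, (∀ i, inner ℂ (v i) x = 0) → K x = 0 := by
    intro x hx
    have hE : ∀ s : ℝ≥0, s ≠ 0 → ∀ y ∈ singularSpace K s, inner ℂ y x = 0 := by
      intro s hs y hy
      have hfin : FiniteDimensional ℂ (singularSpace K s) :=
        ContinuousLinearMap.finite_dimensional_eigenspace hT _ (by
          simpa using hs)
      have hy' := hspan ⟨s, hs⟩ hfin hy
      have hle : Submodule.span ℂ (Set.range fun j => v ⟨⟨s, hs⟩, j⟩) ≤ (ℂ ∙ x)ᗮ := by
        rw [Submodule.span_le]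
        rintro _ ⟨j, rfl⟩
        exact Submodule.mem_orthogonal_singleton_iff_inner_left.mpr (hx _)
      exact Submodule.mem_orthogonal_singleton_iff_inner_left.mp (hle hy')
    have h0 : K.adjoint (K x) ∈
        (⨆ μ, End.eigenspace ((K.adjoint ∘L K : H →L[ℂ] H) : End ℂ H) μ)ᗮ := by
      rw [← Submodule.iInf_orthogonal, Submodule.mem_iInf]
      intro μ
      rw [Submodule.mem_orthogonal]
      intro y hy
      obtain ⟨s, hs⟩ := exists_mem_singularSpace hy
      rw [ContinuousLinearMap.adjoint_inner_right, ← inner_conj_symm,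
        inner_map_map_of_mem_singularSpace hs, ← inner_conj_symm]
      rcases eq_or_ne s 0 with rfl | hs0
      · simp
      · simp [hE s hs0 y hs]
    rw [ContinuousLinearMap.orthogonalComplement_iSup_eigenspaces_eq_bot hT hsym,
      Submodule.mem_bot] at h0
    rw [← norm_eq_zero, ← sq_eq_zero_iff, ← inner_self_eq_norm_sq (𝕜 := ℂ),
      ← ContinuousLinearMap.adjoint_inner_right, h0]
    simp
  obtain ⟨w, e, hw, he⟩ := hv.toSubtypeRange.exists_hilbertBasis_extension
  refine ⟨w, e, ?_⟩
  let g : (Σ s : {s : ℝ≥0 // s ≠ 0}, Fin (finrank ℂ (singularSpace K s))) → w :=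
    fun i => ⟨v i, hw ⟨i, rfl⟩⟩
  have hg : Function.Injective g := fun i j h =>
    hv.linearIndependent.injective (congrArg Subtype.val h)
  have hsupp : Function.support (fun k => ‖K (e k)‖ₑ) ⊆ Set.range g := by
    intro k hk
    by_contra hk'
    refine hk ?_
    have : K (e k) = 0 := by
      refine hker _ fun i => ?_
      have : inner ℂ (e (g i)) (e k) = 0 := e.orthonormal.2 (i := g i) (j := k) fun h => hk' ⟨i, h⟩
      rwa [show e (g i) = v i by rw [he]] at this
    simp [this]
  rw [← hg.tsum_eq hsupp, traceNorm_eq_tsum]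
  refine tsum_congr fun i => ?_
  rw [show e (g i) = v i by rw [he], ← ofReal_norm,
    norm_map_of_mem_singularSpace (hmem i), hv.1 i, mul_one, ENNReal.ofReal_coe_nnreal]

/-- The trace norm is an ideal norm. -/
theorem traceNorm_comp_le (B K : H →L[ℂ] H) (hK : IsCompactOperator K) :
    traceNorm (B ∘L K) ≤ ‖B‖ₑ * traceNorm K := by
  obtain ⟨w, e, he⟩ := exists_hilbertBasis_tsum_enorm_eq K hK
  rw [← he, ← ENNReal.tsum_mul_left]
  exact (traceNorm_le_tsum_enorm _ e).trans (ENNReal.tsum_le_tsum fun k => B.le_opENorm _)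

theorem IsTraceClass.comp_left {K : H →L[ℂ] H} (hK : IsTraceClass K) (B : H →L[ℂ] H) :
    IsTraceClass (B ∘L K) :=
  ⟨hK.1.clm_comp B, ne_top_of_le_ne_top (ENNReal.mul_ne_top enorm_ne_top hK.2)
    (traceNorm_comp_le B K hK.1)⟩

theorem IsTraceClass.toReal_traceNorm_comp_le {K : H →L[ℂ] H} (hK : IsTraceClass K)
    (B : H →L[ℂ] H) : (traceNorm (B ∘L K)).toReal ≤ ‖B‖ * (traceNorm K).toReal := by
  have := ENNReal.toReal_mono (ENNReal.mul_ne_top enorm_ne_top hK.2) (traceNorm_comp_le B K hK.1)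
  simpa using this

end TraceNorm

/-! ### Graphs of unbounded operators -/

section Graph

variable {H : Type*} [AddCommGroup H] [Module ℂ H]

theorem mem_graph_comp {A B : H →ₗ.[ℂ] H} {x y z : H} (hA : (x, y) ∈ A.graph)
    (hB : (y, z) ∈ B.graph) : (x, z) ∈ (comp B A).graph := by
  rw [LinearPMap.mem_graph_iff] at hA hB ⊢
  obtain ⟨⟨x, hx⟩, rfl, rfl⟩ := hA
  obtain ⟨⟨y, hy⟩, h, rfl⟩ := hB
  simp only at h
  subst h
  exact ⟨⟨x, ⟨⟨x, hx⟩, hy, rfl⟩, hx⟩, rfl, rfl⟩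

theorem mem_graph_toPMap_top (T : H →ₗ[ℂ] H) (x : H) : (x, T x) ∈ (T.toPMap ⊤).graph := by
  rw [LinearPMap.mem_graph_iff]
  exact ⟨⟨x, trivial⟩, rfl, rfl⟩

theorem eq_toPMap_top_of_mem_graph {B : H →ₗ.[ℂ] H} {T : H →ₗ[ℂ] H}
    (h : ∀ x, (x, T x) ∈ B.graph) : B = T.toPMap ⊤ := by
  refine LinearPMap.eq_of_eq_graph (le_antisymm ?_ ?_)
  · rintro ⟨x, y⟩ hxy
    rw [B.mem_graph_snd_inj hxy (h x) rfl]
    exact mem_graph_toPMap_top T x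
  · rintro ⟨x, y⟩ hxy
    rw [(T.toPMap ⊤).mem_graph_snd_inj hxy (mem_graph_toPMap_top T x) rfl]
    exact h x

end Graph

/-! ### Derivatives of a holomorphic semigroup -/

theorem isOpen_sector (θ : ℝ) : IsOpen (sector θ) := by
  rw [isOpen_iff_mem_nhds]
  rintro z ⟨hz, hz'⟩
  have harg : ContinuousAt (fun w : ℂ => |w.arg|) z :=
    (Complex.continuousAt_arg (Or.inl hz)).abs
  exact (Complex.continuous_re.continuousAt.eventually_const_lt hz).and
    (harg.eventually_lt_const hz')

theorem sector_mono {θ θ' : ℝ} (h : θ ≤ θ') : sector θ ⊆ sector θ' :=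
  fun _ hz => ⟨hz.1, hz.2.trans_le h⟩

theorem ofReal_mem_sector {θ : ℝ} (hθ : 0 < θ) {t : ℝ} (ht : 0 < t) : (t : ℂ) ∈ sector θ :=
  ⟨by simpa using ht, by rwa [Complex.arg_ofReal_of_nonneg ht.le, abs_zero]⟩

theorem ofReal_mul_mem_sector {θ : ℝ} {t : ℝ} (ht : 0 < t) {z : ℂ} (hz : z ∈ sector θ) :
    (t : ℂ) * z ∈ sector θ :=
  ⟨by simpa using mul_pos ht hz.1, by rw [Complex.arg_real_mul _ ht]; exact hz.2⟩

/-- A sector contains discs about the points of the positive half-line, of radius proportional to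
the distance from the vertex. -/
theorem exists_closedBall_subset_sector {θ : ℝ} (hθ : 0 < θ) :
    ∃ δ : ℝ, 0 < δ ∧ ∀ t : ℝ, 0 < t → Metric.closedBall (t : ℂ) (t * δ) ⊆ sector θ := by
  have h1 : (1 : ℂ) ∈ sector θ := by simpa using ofReal_mem_sector hθ one_pos
  obtain ⟨δ, hδ, hsub⟩ := Metric.nhds_basis_closedBall.mem_iff.mp ((isOpen_sector θ).mem_nhds h1)
  refine ⟨δ, hδ, fun t ht z hz => ?_⟩
  have ht' : (t : ℂ) ≠ 0 := by exact_mod_cast ht.ne'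
  have hz1 : z / t ∈ Metric.closedBall (1 : ℂ) δ := by
    rw [mem_closedBall_iff_norm] at hz ⊢
    rw [show z / t - 1 = (z - t) / t by field_simp, norm_div, Complex.norm_real,
      Real.norm_of_nonneg ht.le, div_le_iff₀ ht, mul_comm]
    exact hz
  have := ofReal_mul_mem_sector ht (hsub hz1)
  rwa [mul_div_cancel₀ _ ht'] at this

section Semigroup

variable {H : Type*} [NormedAddCommGroup H] [InnerProductSpace ℂ H] [CompleteSpace H]
  {θ : ℝ} {U : ℂ → H →L[ℂ] H}

theorem IsQuasiBoundedHolomorphic.analyticAt (hU : IsQuasiBoundedHolomorphic θ U) {z : ℂ}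
    (hz : z ∈ sector θ) : AnalyticAt ℂ U z :=
  hU.holomorphic.analyticAt ((isOpen_sector θ).mem_nhds hz)

theorem IsQuasiBoundedHolomorphic.hasDerivAt_iteratedDeriv (hU : IsQuasiBoundedHolomorphic θ U)
    (n : ℕ) {z : ℂ} (hz : z ∈ sector θ) :
    HasDerivAt (iteratedDeriv n U) (iteratedDeriv (n + 1) U z) z := by
  rw [iteratedDeriv_succ, iteratedDeriv_eq_iterate]
  exact ((hU.analyticAt hz).iterated_deriv n).differentiableAt.hasDerivAt

/-- A linear identity between the operators `U (z + w)` and `U z` passes to derivatives in `z`. -/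
theorem IsQuasiBoundedHolomorphic.iteratedDeriv_add (hU : IsQuasiBoundedHolomorphic θ U)
    (n : ℕ) {z : ℂ} (hz : z ∈ sector θ) (w : ℂ) (Φ : (H →L[ℂ] H) →L[ℂ] (H →L[ℂ] H))
    (hΦ : ∀ z ∈ sector θ, U (z + w) = Φ (U z)) :
    iteratedDeriv n U (z + w) = Φ (iteratedDeriv n U z) := by
  have h1 : (fun z => U (z + w)) =ᶠ[𝓝 z] Φ ∘ U :=
    Filter.eventually_of_mem ((isOpen_sector θ).mem_nhds hz) hΦ
  have h2 := h1.iteratedDeriv_eq n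
  have h3 : iteratedDeriv n (Φ ∘ U) z = Φ (iteratedDeriv n U z) := by
    simp only [iteratedDeriv_eq_iteratedFDeriv]
    rw [Φ.iteratedFDeriv_comp_left (hU.analyticAt hz).contDiffAt (i := n) le_rfl]
    rfl
  rw [h3, iteratedDeriv_comp_add_const] at h2
  exact h2

theorem IsQuasiBoundedHolomorphic.iteratedDeriv_add_eq_comp
    (hU : IsQuasiBoundedHolomorphic θ U) (n : ℕ) {z w : ℂ} (hz : z ∈ sector θ)
    (hw : w ∈ sector θ) : iteratedDeriv n U (z + w) = iteratedDeriv n U z ∘L U w :=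
  hU.iteratedDeriv_add n hz w ((ContinuousLinearMap.compL ℂ H H H).flip (U w))
    fun z hz => hU.map_add z hz w hw

theorem IsQuasiBoundedHolomorphic.comp_iteratedDeriv
    (hU : IsQuasiBoundedHolomorphic θ U) (n : ℕ) {z w : ℂ} (hz : z ∈ sector θ)
    (hw : w ∈ sector θ) : iteratedDeriv n U (z + w) = U w ∘L iteratedDeriv n U z :=
  hU.iteratedDeriv_add n hz w (ContinuousLinearMap.compL ℂ H H H (U w))
    fun z hz => by rw [add_comm]; exact hU.map_add w hw z hz

/-- The range of the `n`-th derivative of the semigroup lies in the domain of the generator, which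
acts there as `-d/dt`. -/
theorem IsGenerator.iteratedDeriv_mem_graph {A : H →ₗ.[ℂ] H} (hA : IsGenerator A U)
    (hU : IsQuasiBoundedHolomorphic θ U) (hθ : 0 < θ) (n : ℕ) {t : ℝ} (ht : 0 < t) (x : H) :
    (iteratedDeriv n U t x, -iteratedDeriv (n + 1) U t x) ∈ A.graph := by
  rw [hA]
  have ht' := ofReal_mem_sector hθ ht
  have h1 : HasDerivAt (fun z => iteratedDeriv n U z x) (iteratedDeriv (n + 1) U t x) (t : ℂ) := by
    simpa using (hU.hasDerivAt_iteratedDeriv n ht').clm_apply (hasDerivAt_const (t : ℂ) x)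
  have h2 : Tendsto (fun s : ℝ => (s : ℂ)) (𝓝[>] 0) (𝓝[≠] 0) := by
    refine tendsto_nhdsWithin_iff.mpr ⟨?_, ?_⟩
    · exact (Complex.continuous_ofReal.tendsto' 0 0 (by simp)).mono_left nhdsWithin_le_nhds
    · filter_upwards [self_mem_nhdsWithin] with s hs
      simpa using ne_of_gt hs
  have h3 := (h1.tendsto_slope_zero.comp h2).neg
  refine h3.congr' ?_
  filter_upwards [self_mem_nhdsWithin] with s hs
  simp only [Function.comp_apply]
  rw [hU.comp_iteratedDeriv n ht' (ofReal_mem_sector hθ hs), ← smul_neg, neg_sub]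
  rfl

theorem IsGenerator.mem_graph_pow {A : H →ₗ.[ℂ] H} (hA : IsGenerator A U)
    (hU : IsQuasiBoundedHolomorphic θ U) (hθ : 0 < θ) (n : ℕ) {t : ℝ} (ht : 0 < t) (x : H) :
    (U t x, (-1 : ℂ) ^ n • iteratedDeriv n U t x) ∈ (pow A n).graph := by
  induction n with
  | zero => simp [pow]
  | succ n ih =>
    refine mem_graph_comp ih ?_
    have := A.graph.smul_mem ((-1 : ℂ) ^ n) (hA.iteratedDeriv_mem_graph hU hθ n ht x)
    rw [pow_succ, mul_smul, neg_one_smul]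
    exact this

/-- `A ^ n exp (-t A)` is everywhere defined, and is the `n`-th derivative of the semigroup up to
sign. -/
theorem IsGenerator.pow_comp_eq {A : H →ₗ.[ℂ] H} (hA : IsGenerator A U)
    (hU : IsQuasiBoundedHolomorphic θ U) (hθ : 0 < θ) (n : ℕ) {t : ℝ} (ht : 0 < t) :
    comp (pow A n) ((U (t : ℂ) : H →ₗ[ℂ] H).toPMap ⊤) =
      (((-1 : ℂ) ^ n • iteratedDeriv n U t : H →L[ℂ] H) : H →ₗ[ℂ] H).toPMap ⊤ :=
  eq_toPMap_top_of_mem_graph fun x =>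
    mem_graph_comp (mem_graph_toPMap_top _ x) (hA.mem_graph_pow hU hθ n ht x)

/-- Cauchy's estimate on discs of radius proportional to `t`. -/
theorem IsQuasiBoundedHolomorphic.exists_norm_iteratedDeriv_le
    (hU : IsQuasiBoundedHolomorphic θ U) (hθ : 0 < θ) (n : ℕ) :
    ∃ C : ℝ, ∀ t : ℝ, 0 < t → t ≤ 1 → ‖iteratedDeriv n U t‖ ≤ C / t ^ n := by
  obtain ⟨δ, hδ, hsub⟩ := exists_closedBall_subset_sector (half_pos hθ)
  obtain ⟨M, c, hM, hbd⟩ := hU.quasi_bounded (θ / 2) (half_pos hθ) (half_lt_self hθ)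
  refine ⟨n.factorial * (M * Real.exp (|c| * (1 + δ))) / δ ^ n, fun t ht ht1 => ?_⟩
  have hR : 0 < t * δ := mul_pos ht hδ
  have hd : DiffContOnCl ℂ U (Metric.ball (t : ℂ) (t * δ)) := by
    refine DifferentiableOn.diffContOnCl (hU.holomorphic.mono ?_)
    exact Metric.closure_ball_subset_closedBall.trans
      ((hsub t ht).trans (sector_mono (half_le_self hθ.le)))
  refine (Complex.norm_iteratedDeriv_le_of_forall_mem_sphere_norm_le
    (C := M * Real.exp (|c| * (1 + δ))) n hR hd fun z hz => ?_).trans_eq ?_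
  · refine (hbd z (subset_closure (hsub t ht (Metric.sphere_subset_closedBall hz)))).trans ?_
    refine mul_le_mul_of_nonneg_left (Real.exp_le_exp.mpr ?_) (zero_le_one.trans hM)
    have hz1 : ‖z‖ ≤ 1 + δ := by
      have h1 : ‖z - t‖ = t * δ := by simpa [dist_eq_norm] using hz
      have h2 : ‖z‖ ≤ ‖z - t‖ + ‖(t : ℂ)‖ := by simpa using norm_add_le (z - t) t
      rw [h1, Complex.norm_real, Real.norm_of_nonneg ht.le] at h2
      nlinarith
    exact (mul_le_mul_of_nonneg_right (le_abs_self c) (norm_nonneg z)).trans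
      (mul_le_mul_of_nonneg_left hz1 (abs_nonneg c))
  · rw [mul_pow, div_div, mul_comm (t ^ n)]

end Semigroup

/-! ### Smoothly varying functions -/

/-- `φ` is smooth near infinity and tends there to `c`, while all its derivatives tend to zero. -/
structure HasSmoothLimit (φ : ℝ → ℝ) (c : ℝ) : Prop where
  contDiffAt : ∀ᶠ x in atTop, ContDiffAt ℝ ∞ φ x
  tendsto_iteratedDeriv :
    ∀ n : ℕ, Tendsto (iteratedDeriv n φ) atTop (𝓝 (if n = 0 then c else 0))

namespace HasSmoothLimit

variable {φ ψ : ℝ → ℝ} {c d : ℝ}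

theorem tendsto (hφ : HasSmoothLimit φ c) : Tendsto φ atTop (𝓝 c) := by
  simpa using hφ.tendsto_iteratedDeriv 0

theorem const (c : ℝ) : HasSmoothLimit (fun _ => c) c where
  contDiffAt := Eventually.of_forall fun _ => contDiffAt_const
  tendsto_iteratedDeriv _ :=
    tendsto_const_nhds.congr fun _ => iteratedDeriv_const.symm

theorem add (hφ : HasSmoothLimit φ c) (hψ : HasSmoothLimit ψ d) :
    HasSmoothLimit (φ + ψ) (c + d) where
  contDiffAt := by
    filter_upwards [hφ.contDiffAt, hψ.contDiffAt] with x h1 h2 using h1.add h2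
  tendsto_iteratedDeriv n := by
    have h := (hφ.tendsto_iteratedDeriv n).add (hψ.tendsto_iteratedDeriv n)
    rw [show (if n = 0 then c else 0) + (if n = 0 then d else 0) = if n = 0 then c + d else 0 by
      split_ifs <;> simp] at h
    refine h.congr' ?_
    filter_upwards [hφ.contDiffAt, hψ.contDiffAt] with x h1 h2
    have hn : (n : WithTop ℕ∞) ≤ ((⊤ : ℕ∞) : WithTop ℕ∞) := by exact_mod_cast le_top
    rw [iteratedDeriv_add (h1.of_le hn) (h2.of_le hn)]

theorem mul (hφ : HasSmoothLimit φ c) (hψ : HasSmoothLimit ψ d) :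
    HasSmoothLimit (φ * ψ) (c * d) where
  contDiffAt := by
    filter_upwards [hφ.contDiffAt, hψ.contDiffAt] with x h1 h2 using h1.mul h2
  tendsto_iteratedDeriv n := by
    have h := tendsto_finsetSum (Finset.range (n + 1)) fun i _ =>
      (((hφ.tendsto_iteratedDeriv i).const_mul (n.choose i : ℝ)).mul
        (hψ.tendsto_iteratedDeriv (n - i)))
    -- in each Leibniz term but the one for `n = 0`, some factor tends to zero
    have hlim : ∑ i ∈ Finset.range (n + 1), (n.choose i : ℝ) * (if i = 0 then c else 0) *
        (if n - i = 0 then d else 0) = if n = 0 then c * d else 0 := by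
      rcases eq_or_ne n 0 with rfl | hn
      · simp
      · rw [if_neg hn]
        refine Finset.sum_eq_zero fun i _ => ?_
        rcases eq_or_ne i 0 with rfl | hi
        · simp [hn]
        · simp [hi]
    rw [hlim] at h
    refine h.congr' ?_
    filter_upwards [hφ.contDiffAt, hψ.contDiffAt] with x h1 h2
    have hn : (n : WithTop ℕ∞) ≤ ((⊤ : ℕ∞) : WithTop ℕ∞) := by exact_mod_cast le_top
    rw [iteratedDeriv_mul (h1.of_le hn) (h2.of_le hn)]

theorem deriv (hφ : HasSmoothLimit φ c) : HasSmoothLimit (deriv φ) 0 where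
  contDiffAt := by
    filter_upwards [hφ.contDiffAt] with x h
    exact (h.fderiv_right (m := ∞) le_rfl).clm_apply contDiffAt_const
  tendsto_iteratedDeriv n := by
    have h := hφ.tendsto_iteratedDeriv (n + 1)
    rw [iteratedDeriv_succ'] at h
    simpa using h

end HasSmoothLimit

theorem eventually_nhdsGT_eventually_nhds {P : ℝ → Prop} (h : ∀ᶠ t in 𝓝[>] (0 : ℝ), P t) :
    ∀ᶠ t in 𝓝[>] (0 : ℝ), ∀ᶠ s in 𝓝 t, P s := by
  filter_upwards [eventually_eventually_nhdsWithin.mpr h, self_mem_nhdsWithin] with t ht ht0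
  rwa [isOpen_Ioi.nhdsWithin_eq ht0] at ht

theorem tendsto_neg_log_nhdsGT : Tendsto (fun t : ℝ => -Real.log t) (𝓝[>] 0) atTop :=
  tendsto_neg_atBot_atTop.comp Real.tendsto_log_nhdsGT_zero

theorem tendsto_half_nhdsGT : Tendsto (fun t : ℝ => t / 2) (𝓝[>] 0) (𝓝[>] 0) := by
  refine tendsto_nhdsWithin_iff.mpr ⟨?_, ?_⟩
  · exact ((continuous_id.div_const 2).tendsto' 0 0 (by simp)).mono_left nhdsWithin_le_nhds
  · filter_upwards [self_mem_nhdsWithin] with t ht using half_pos (Set.mem_Ioi.mp ht)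

namespace SmoothlyVaryingWith

variable {p : ℝ} {f : ℝ → ℝ}

theorem eventually_pos (hf : SmoothlyVaryingWith p f) : ∀ᶠ x in atTop, 0 < f x := by
  obtain ⟨⟨a, -, hpos, -⟩, -, -⟩ := hf
  filter_upwards [eventually_ge_atTop a] with x hx using hpos x hx

theorem eventually_pos_inv (hf : SmoothlyVaryingWith p f) : ∀ᶠ t in 𝓝[>] (0 : ℝ), 0 < f t⁻¹ :=
  tendsto_inv_nhdsGT_zero.eventually hf.eventually_pos

theorem contDiffAt_log (hf : SmoothlyVaryingWith p f) :
    ∀ᶠ x in atTop, ContDiffAt ℝ ∞ (fun x => Real.log (f (Real.exp x))) x := by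
  obtain ⟨⟨a, -, hpos, hsm⟩, -, -⟩ := hf
  filter_upwards [Real.tendsto_exp_atTop.eventually (eventually_gt_atTop a)] with x hx
  have h1 : ContDiffAt ℝ ∞ f (Real.exp x) := hsm.contDiffAt (Ici_mem_nhds hx)
  exact (h1.comp x Real.contDiff_exp.contDiffAt).log (hpos _ hx.le).ne'

theorem hasSmoothLimit (hf : SmoothlyVaryingWith p f) :
    HasSmoothLimit (deriv fun x => Real.log (f (Real.exp x))) p where
  contDiffAt := by
    filter_upwards [hf.contDiffAt_log] with x h
    exact (h.fderiv_right (m := ∞) le_rfl).clm_apply contDiffAt_const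
  tendsto_iteratedDeriv n := by
    rcases n with _ | n
    · simpa using hf.2.1
    · rw [← iteratedDeriv_succ', if_neg n.succ_ne_zero]
      exact hf.2.2 _ (by omega)

theorem eventually_eq_exp (hf : SmoothlyVaryingWith p f) : ∀ᶠ t in 𝓝[>] (0 : ℝ),
    f t⁻¹ = Real.exp (Real.log (f (Real.exp (-Real.log t)))) := by
  filter_upwards [hf.eventually_pos_inv, self_mem_nhdsWithin] with t ht ht0
  rw [Real.exp_neg, Real.exp_log ht0, Real.exp_log ht]

theorem eventually_hasDerivAt_inv (hf : SmoothlyVaryingWith p f) : ∀ᶠ t in 𝓝[>] (0 : ℝ),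
    HasDerivAt (fun t => f t⁻¹)
      (f t⁻¹ * (deriv (fun x => Real.log (f (Real.exp x))) (-Real.log t) * -t⁻¹)) t := by
  filter_upwards [eventually_nhdsGT_eventually_nhds hf.eventually_eq_exp, self_mem_nhdsWithin,
    tendsto_neg_log_nhdsGT.eventually hf.contDiffAt_log] with t hev ht0 hsm
  have h1 := (hsm.differentiableAt (by simp)).hasDerivAt
  have h2 := (h1.comp t (Real.hasDerivAt_log (ne_of_gt ht0)).neg).exp
  refine (h2.congr_of_eventuallyEq hev).congr_deriv ?_
  rw [hev.self_of_nhds]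
  rfl

/-- The derivatives of `g t = f t⁻¹` are `t ^ (-n) * g t` times a function of `-log t` that has a
nonzero limit at infinity, namely `(-1) ^ n * p * (p + 1) * ⋯ * (p + n - 1)`. -/
theorem exists_iteratedDeriv_eq (hp : 0 < p) (hf : SmoothlyVaryingWith p f) (n : ℕ) :
    ∃ (Q : ℝ → ℝ) (c : ℝ), HasSmoothLimit Q c ∧ c ≠ 0 ∧ ∀ᶠ t in 𝓝[>] (0 : ℝ),
      iteratedDeriv n (fun t => f t⁻¹) t = f t⁻¹ / t ^ n * Q (-Real.log t) := by
  induction n with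
  | zero => exact ⟨fun _ => 1, 1, .const 1, one_ne_zero, by simp⟩
  | succ n ih =>
    obtain ⟨Q, c, hQ, hc, hev⟩ := ih
    set k : ℝ → ℝ := deriv fun x => Real.log (f (Real.exp x)) with hk
    refine ⟨(fun _ => -1) * (deriv Q + ((fun _ => (n : ℝ)) + k) * Q), -1 * (0 + (n + p) * c),
      (HasSmoothLimit.const (-1)).mul
        (hQ.deriv.add (((HasSmoothLimit.const (n : ℝ)).add hf.hasSmoothLimit).mul hQ)), ?_, ?_⟩
    · have : (n : ℝ) + p ≠ 0 := by positivity
      simp [this, hc]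
    · filter_upwards [eventually_nhdsGT_eventually_nhds hev, self_mem_nhdsWithin,
        hf.eventually_hasDerivAt_inv,
        tendsto_neg_log_nhdsGT.eventually hQ.contDiffAt] with t hev ht0 hg hQt
      have ht : t ≠ 0 := ne_of_gt ht0
      have h1 := (hQt.differentiableAt (by simp)).hasDerivAt.comp t (Real.hasDerivAt_log ht).neg
      have h2 := (hg.div (hasDerivAt_pow n t) (pow_ne_zero n ht)).mul h1
      rw [iteratedDeriv_succ, (h2.congr_of_eventuallyEq hev).deriv]
      simp only [Pi.mul_apply, Pi.add_apply, Pi.div_apply, Pi.neg_apply, Function.comp_apply, ← hk]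
      rcases n with _ | n
      · simp
        field_simp
      · simp only [Nat.add_sub_cancel]
        field_simp
        ring

theorem eventually_iteratedDeriv_ne_zero (hp : 0 < p) (hf : SmoothlyVaryingWith p f) (n : ℕ) :
    ∀ᶠ t in 𝓝[>] (0 : ℝ), iteratedDeriv n (fun t => f t⁻¹) t ≠ 0 := by
  obtain ⟨Q, c, hQ, hc, hev⟩ := hf.exists_iteratedDeriv_eq hp n
  filter_upwards [hev, self_mem_nhdsWithin, hf.eventually_pos_inv,
    tendsto_neg_log_nhdsGT.eventually (hQ.tendsto.eventually_ne hc)] with t h ht0 hpos hne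
  rw [h]
  exact mul_ne_zero (div_ne_zero hpos.ne' (pow_ne_zero n (ne_of_gt ht0))) hne

theorem isBigO_iteratedDeriv (hp : 0 < p) (hf : SmoothlyVaryingWith p f) (n : ℕ) :
    (fun t : ℝ => f t⁻¹ / t ^ n) =O[𝓝[>] 0] iteratedDeriv n fun t => f t⁻¹ := by
  obtain ⟨Q, c, hQ, hc, hev⟩ := hf.exists_iteratedDeriv_eq hp n
  have hlim := hQ.tendsto.comp tendsto_neg_log_nhdsGT
  have h1 : (fun t => (Q (-Real.log t))⁻¹) =O[𝓝[>] (0 : ℝ)] fun _ => (1 : ℝ) :=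
    (hlim.inv₀ hc).isBigO_one ℝ
  refine ((isBigO_refl (iteratedDeriv n fun t => f t⁻¹) _).mul h1).congr' ?_ (by simp)
  filter_upwards [hev, hlim.eventually_ne hc] with t h hne
  rw [h]
  exact mul_inv_cancel_right₀ hne _

/-- A smoothly varying function is doubling at infinity. -/
theorem isBigO_comp_half_inv (hf : SmoothlyVaryingWith p f) :
    (fun t : ℝ => f (t / 2)⁻¹) =O[𝓝[>] 0] fun t => f t⁻¹ := by
  set h : ℝ → ℝ := fun x => Real.log (f (Real.exp x)) with hh
  obtain ⟨X, hX⟩ := eventually_atTop.mp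
    (hf.contDiffAt_log.and (hf.2.1.eventually_le_const (lt_add_one p)))
  have hle : ∀ x, X ≤ x → h (x + Real.log 2) ≤ (p + 1) * Real.log 2 + h x := by
    intro x hx
    have hd : ∀ y ∈ Set.Ici X, DifferentiableAt ℝ h y := fun y hy =>
      (hX y hy).1.differentiableAt (by simp)
    have hl : 0 < Real.log 2 := Real.log_pos one_lt_two
    have := (convex_Ici X).image_sub_le_mul_sub_of_deriv_le
      (fun y hy => (hd y hy).continuousAt.continuousWithinAt)
      (fun y hy => (hd y (interior_subset hy)).differentiableWithinAt)
      (fun y hy => (hX y (interior_subset hy)).2) x hx (x + Real.log 2)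
      (hx.trans (by linarith : x ≤ x + Real.log 2)) (by linarith)
    rw [add_sub_cancel_left] at this
    linarith
  refine IsBigO.of_bound (Real.exp ((p + 1) * Real.log 2)) ?_
  filter_upwards [hf.eventually_eq_exp, tendsto_half_nhdsGT.eventually hf.eventually_eq_exp,
    tendsto_neg_log_nhdsGT.eventually (eventually_ge_atTop X), self_mem_nhdsWithin]
    with t h1 h2 h3 ht
  rw [h1, h2, Real.norm_of_nonneg (Real.exp_nonneg _), Real.norm_of_nonneg (Real.exp_nonneg _),
    ← Real.exp_add, Real.exp_le_exp, Real.log_div (ne_of_gt ht) two_ne_zero, neg_sub,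
    sub_eq_neg_add]
  exact hle _ h3

end SmoothlyVaryingWith

/-! ### Trace norms of the derivatives of a Gibbs semigroup -/

section Gibbs

variable {H : Type*} [NormedAddCommGroup H] [InnerProductSpace ℂ H] [CompleteSpace H]
  {θ : ℝ} {U : ℂ → H →L[ℂ] H}

/-- The semigroup law splits off half of the time, which carries the derivative; the other half
carries the trace norm. -/
theorem IsHolomorphicGibbs.smul_iteratedDeriv_eq_comp (hU : IsHolomorphicGibbs θ U) (hθ : 0 < θ)
    (n : ℕ) (a : ℂ) {t : ℝ} (ht : 0 < t) :
    a • iteratedDeriv n U t =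
      (a • iteratedDeriv n U ((t / 2 : ℝ) : ℂ)) ∘L U ((t / 2 : ℝ) : ℂ) := by
  have h2 := ofReal_mem_sector hθ (half_pos ht)
  rw [ContinuousLinearMap.smul_comp,
    ← hU.toIsQuasiBoundedHolomorphic.iteratedDeriv_add_eq_comp n h2 h2, ← Complex.ofReal_add,
    add_halves]

theorem IsHolomorphicGibbs.isTraceClass_smul_iteratedDeriv (hU : IsHolomorphicGibbs θ U)
    (hθ : 0 < θ) (n : ℕ) (a : ℂ) {t : ℝ} (ht : 0 < t) :
    IsTraceClass (a • iteratedDeriv n U t) := by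
  rw [hU.smul_iteratedDeriv_eq_comp hθ n a ht]
  exact (hU.traceClass _ (ofReal_mem_sector hθ (half_pos ht))).comp_left _

theorem IsHolomorphicGibbs.isBigO_traceNorm_smul_iteratedDeriv (hU : IsHolomorphicGibbs θ U)
    (hθ : 0 < θ) (n : ℕ) (a : ℂ) :
    (fun t : ℝ => (traceNorm (a • iteratedDeriv n U t)).toReal) =O[𝓝[>] 0]
      fun t : ℝ => (traceNorm (U ((t / 2 : ℝ) : ℂ))).toReal / t ^ n := by
  obtain ⟨C, hC⟩ := hU.toIsQuasiBoundedHolomorphic.exists_norm_iteratedDeriv_le hθ n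
  refine IsBigO.of_bound (‖a‖ * (C * 2 ^ n)) ?_
  filter_upwards [Ioc_mem_nhdsGT one_pos] with t ht
  have htr := hU.traceClass _ (ofReal_mem_sector hθ (half_pos ht.1))
  have hC' := hC (t / 2) (half_pos ht.1) (by linarith [ht.1, ht.2])
  have ht' : 0 < t := ht.1
  rw [hU.smul_iteratedDeriv_eq_comp hθ n a ht.1, Real.norm_of_nonneg ENNReal.toReal_nonneg,
    Real.norm_of_nonneg (by positivity)]
  refine (htr.toReal_traceNorm_comp_le _).trans ?_
  rw [norm_smul]
  calc ‖a‖ * ‖iteratedDeriv n U ((t / 2 : ℝ) : ℂ)‖ * (traceNorm (U ((t / 2 : ℝ) : ℂ))).toReal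
      ≤ ‖a‖ * (C / (t / 2) ^ n) * (traceNorm (U ((t / 2 : ℝ) : ℂ))).toReal := by gcongr
    _ = ‖a‖ * (C * 2 ^ n) * ((traceNorm (U ((t / 2 : ℝ) : ℂ))).toReal / t ^ n) := by
      rw [div_pow]
      field_simp

end Gibbs

end GibbsSemigroup

theorem theorem5p14 {H : Type*} [NormedAddCommGroup H] [InnerProductSpace ℂ H] [CompleteSpace H]
    [TopologicalSpace.SeparableSpace H]
    (θ : ℝ) (hθ₀ : 0 < θ) (hθ : θ < Real.pi / 2)
    (A : H →ₗ.[ℂ] H) (U : ℂ → H →L[ℂ] H)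
    (hU : GibbsSemigroup.IsHolomorphicGibbs θ U) (hA : GibbsSemigroup.IsGenerator A U)
    (f : ℝ → ℝ) (hf : GibbsSemigroup.SmoothlyVarying f)
    (hF : GibbsSemigroup.IsBigOAtZero
      (fun t : ℝ => (GibbsSemigroup.traceNorm (U (t : ℂ))).toReal) (fun t : ℝ => f t⁻¹)) :
    ∀ n : ℕ, ∃ T : ℝ → H →L[ℂ] H,
      -- `T t` is the operator `A ^ n exp (-t A)`, everywhere defined and of trace class
      (∀ t : ℝ, 0 < t →
        GibbsSemigroup.comp (GibbsSemigroup.pow A n) ((U (t : ℂ) : H →ₗ[ℂ] H).toPMap ⊤) =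
          (T t : H →ₗ[ℂ] H).toPMap ⊤ ∧
        GibbsSemigroup.IsTraceClass (T t)) ∧
      GibbsSemigroup.IsBigOAtZero
        (fun t : ℝ => (GibbsSemigroup.traceNorm (T t)).toReal)
        (iteratedDeriv n fun t : ℝ => f t⁻¹) := by
  intro n
  obtain ⟨p, hp, hfp⟩ := hf
  have hU' := hU.toIsQuasiBoundedHolomorphic
  refine ⟨fun t => (-1 : ℂ) ^ n • iteratedDeriv n U t, fun t ht =>
    ⟨hA.pow_comp_eq hU' hθ₀ n ht, hU.isTraceClass_smul_iteratedDeriv hθ₀ n _ ht⟩,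
    hfp.eventually_iteratedDeriv_ne_zero hp n, ?_⟩
  have h1 := (hF.2.comp_tendsto GibbsSemigroup.tendsto_half_nhdsGT).trans hfp.isBigO_comp_half_inv
  have h2 := h1.mul (isBigO_refl (fun t : ℝ => (t ^ n)⁻¹) (𝓝[>] 0))
  exact (hU.isBigO_traceNorm_smul_iteratedDeriv hθ₀ n _).trans
    (h2.trans (hfp.isBigO_iteratedDeriv hp n))
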